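/- For a group $G$, let $\mathcal N(G)$ be its group von Neumann algebra, i.e. the algebra of bounded operators on $\ell^2(G)$ commuting with the right translations, with trace $\mathrm{tr}(a)=\langle a\delta_1,\delta_1\rangle$. For a left $\mathcal N(G)$-module $M$ let $\dim_{\mathcal N(G)} M\in[0,\infty]$ be Lück's von Neumann dimension, i.e. the supremum of $\dim_{\mathcal N(G)} P$ over all finitely generated projective submodules $P\subseteq M$, where $\dim_{\mathcal N(G)} P=\sum_i \mathrm{tr}(A_{ii})$ for any idempotent matrix $A\in M_n(\mathcal N(G))$ with $P\cong \mathcal N(G)^n A$. The first $\ell^2$-Betti number of $G$ is $$b_1^{(2)}(G)=\dim_{\mathcal N(G)} H_1(G;\mathcal N(G)),\qquad H_1(G;\mathcal N(G))=\mathrm{Tor}_1^{\mathbb C[G]}(\mathcal N(G),\mathbb C),$$ and $\bar b_1^{(2)}(G)=\liminf_{H\le G} b_1^{(2)}(H)$, where the limit inferior is taken over the directed system of all finitely generated subgroups $H$ of $G$. **Theorem.** Let $p$ be a prime and let $G$ be a group of exponent $p$, i.e. $g^p=1$ for all $g\in G$ ($G$ need not be finitely generated or countable). Then $$b_1^{(2)}(G)\le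 2p-2\qquad\text{and}\qquad \bar b_1^{(2)}(G)\le 2p-2 .$$ -/

import Mathlib

open scoped ENNReal

noncomputable section

namespace L2Betti

/-- The Hilbert space `ℓ²(G)` of square-summable complex functions on `G`. -/
abbrev ell2 (G : Type*) : Type _ := lp (fun _ : G => ℂ) 2

/-- The basis vector `δ_g` of `ℓ²(G)`. -/
def delta {G : Type*} [DecidableEq G] (g : G) : ell2 G := lp.single 2 g (1 : ℂ)

theorem memlp_comp {G : Type*} (e : Equiv.Perm G) {f : G → ℂ}
    (hf : Memℓp (E := fun _ : G => ℂ) f 2) : Memℓp (E := fun _ : G => ℂ) (f ∘ e) 2 := by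
  have h2 : 0 < (2 : ℝ≥0∞).toReal := by norm_num
  rw [memℓp_gen_iff h2] at hf ⊢
  exact (e.summable_iff (f := fun x => ‖f x‖ ^ (2 : ℝ≥0∞).toReal)).2 hf

/-- The unitary operator of `ℓ²(G)` that permutes the basis by `e`: it sends `δ_x` to `δ_(e x)`,
that is, `f` to `f ∘ e⁻¹`. -/
def permUnitary {G : Type*} (e : Equiv.Perm G) : ell2 G ≃ₗᵢ[ℂ] ell2 G where
  toFun f := ⟨fun x => f (e.symm x), memlp_comp e.symm (lp.memℓp f)⟩
  invFun f := ⟨fun x => f (e x), memlp_comp e (lp.memℓp f)⟩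
  map_add' f g := by ext x; rfl
  map_smul' c f := by ext x; rfl
  left_inv f := by
    ext x
    change f (e.symm (e x)) = f x
    rw [e.symm_apply_apply]
  right_inv f := by
    ext x
    change f (e (e.symm x)) = f x
    rw [e.apply_symm_apply]
  norm_map' f := by
    have h2 : 0 < (2 : ℝ≥0∞).toReal := by norm_num
    rw [lp.norm_eq_tsum_rpow h2, lp.norm_eq_tsum_rpow h2]
    congr 1
    exact e.symm.tsum_eq (fun x => ‖f x‖ ^ (2 : ℝ≥0∞).toReal)

variable (G : Type*) [Group G]

/-- The operator of left translation by `g` on `ℓ²(G)`, `δ_x ↦ δ_(g x)`. -/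
def leftTranslation {G : Type*} [Group G] (g : G) : ell2 G →L[ℂ] ell2 G :=
  (permUnitary (Equiv.mulLeft g)).toContinuousLinearEquiv.toContinuousLinearMap

/-- The operator of right translation by `g` on `ℓ²(G)`, `δ_x ↦ δ_(x g)`. -/
def rightTranslation {G : Type*} [Group G] (g : G) : ell2 G →L[ℂ] ell2 G :=
  (permUnitary (Equiv.mulRight g)).toContinuousLinearEquiv.toContinuousLinearMap

theorem star_rightTranslation {G : Type*} [Group G] (g : G) :
    star (rightTranslation g) = rightTranslation g⁻¹ := by
  refine (LinearIsometryEquiv.star_eq_symm (permUnitary (Equiv.mulRight g))).trans ?_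
  ext f x
  change f (x * g) = f (x * g⁻¹⁻¹)
  rw [inv_inv]

/-- The group von Neumann algebra `N(G)` as a star subalgebra of the bounded operators on `ℓ²(G)`:
all bounded operators which commute with the right translations by elements of `G`. -/
def groupVN : StarSubalgebra ℂ (ell2 G →L[ℂ] ell2 G) :=
  StarSubalgebra.centralizer ℂ (Set.range (rightTranslation (G := G)))

theorem leftTranslation_mem {G : Type*} [Group G] (g : G) : leftTranslation g ∈ groupVN G := by
  have key : ∀ h : G, rightTranslation h * leftTranslation g
      = leftTranslation g * rightTranslation h := by
    intro h
    ext f x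
    change f (g⁻¹ * (x * h⁻¹)) = f (g⁻¹ * x * h⁻¹)
    rw [mul_assoc]
  rw [groupVN, StarSubalgebra.mem_centralizer_iff]
  rintro _ ⟨h, rfl⟩
  refine ⟨key h, ?_⟩
  rw [star_rightTranslation]
  exact key h⁻¹

/-- The ring `N(G)`. -/
def VN : Type _ := ↥(groupVN G)

instance instRingVN : Ring (VN G) := inferInstanceAs (Ring ↥(groupVN G))

/-- The bounded operator on `ℓ²(G)` that an element of `N(G)` is. -/
def VN.op {G : Type*} [Group G] (a : VN G) : ell2 G →L[ℂ] ell2 G := a.1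

/-- The canonical map `G → N(G)`, `g ↦` left translation by `g`. -/
def incl {G : Type*} [Group G] (g : G) : VN G := ⟨leftTranslation g, leftTranslation_mem g⟩

theorem incl_one {G : Type*} [Group G] : incl (1 : G) = 1 := by
  apply Subtype.ext
  ext f x
  change f ((1 : G)⁻¹ * x) = f x
  simp

theorem incl_mul {G : Type*} [Group G] (g h : G) : incl (g * h) = incl g * incl h := by
  apply Subtype.ext
  ext f x
  change f ((g * h)⁻¹ * x) = f (h⁻¹ * (g⁻¹ * x))
  simp [mul_assoc]

open Classical in
/-- The von Neumann trace `tr(a) = ⟨a δ₁, δ₁⟩` (Mathlib's inner product is linear in the second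
variable). -/
def vnTrace {G : Type*} [Group G] (a : VN G) : ℂ :=
  inner ℂ (delta (1 : G)) (a.op (delta (1 : G)))

/-- The left `N(G)`-module `N(G)ⁿ · A` of a square matrix `A` over `N(G)`, acting on row vectors
from the right. Up to isomorphism, the finitely generated projective left modules are those with
`A` idempotent. -/
abbrev rowModule {G : Type*} [Group G] {n : ℕ} (A : Matrix (Fin n) (Fin n) (VN G)) :
    Submodule (VN G) (Fin n → VN G) :=
  LinearMap.range (Matrix.toLinearMapRight' A)

/-- The (extended) von Neumann dimension of an arbitrary `N(G)`-module `M`: the supremum of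
`dim P` over the finitely generated projective submodules `P` of `M`. Such a `P` is the
isomorphic image of `N(G)ⁿ · A` for an idempotent matrix `A`, and `dim P` is the trace
of `A`, which is a nonnegative real number. -/
def vnDim (M : Type*) [AddCommGroup M] [Module (VN G) M] : ℝ≥0∞ :=
  ⨆ (n : ℕ) (A : Matrix (Fin n) (Fin n) (VN G)) (_ : IsIdempotentElem A)
    (_ : ∃ f : rowModule A →ₗ[VN G] M, Function.Injective f),
    ENNReal.ofReal (∑ i, vnTrace (A i i)).re

/-- The first differential of `N(G) ⊗_{ℂG} (bar resolution of ℂ)`: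
`x ⊗ [g] ↦ x g - x`. -/
def d₁ : (G →₀ VN G) →ₗ[VN G] VN G :=
  Finsupp.linearCombination (VN G) fun g : G => incl g - 1

/-- The second differential of `N(G) ⊗_{ℂG} (bar resolution of ℂ)`:
`x ⊗ [g|h] ↦ x g ⊗ [h] - x ⊗ [g h] + x ⊗ [g]`. -/
def d₂ : (G × G →₀ VN G) →ₗ[VN G] (G →₀ VN G) :=
  Finsupp.linearCombination (VN G) fun q : G × G =>
    Finsupp.single q.2 (incl q.1) - Finsupp.single (q.1 * q.2) 1 + Finsupp.single q.1 1

theorem d₁_comp_d₂ : d₁ G ∘ₗ d₂ G = 0 := by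
  ext q : 2
  simp [d₁, d₂, incl_mul, mul_sub]

/-- The homology `ker g / im f` of a complex of left modules `A → B → C` at `B`. -/
def Homology {R A B C : Type*} [Ring R] [AddCommGroup A] [AddCommGroup B] [AddCommGroup C]
    [Module R A] [Module R B] [Module R C] (f : A →ₗ[R] B) (g : B →ₗ[R] C) : Type _ :=
  LinearMap.ker g ⧸ (LinearMap.range f).submoduleOf (LinearMap.ker g)

section

variable {R A B C : Type*} [Ring R] [AddCommGroup A] [AddCommGroup B] [AddCommGroup C]
  [Module R A] [Module R B] [Module R C] (f : A →ₗ[R] B) (g : B →ₗ[R] C)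

instance instAddCommGroupHomology : AddCommGroup (Homology f g) :=
  inferInstanceAs
    (AddCommGroup (LinearMap.ker g ⧸ (LinearMap.range f).submoduleOf (LinearMap.ker g)))

instance instModuleHomology : Module R (Homology f g) :=
  inferInstanceAs
    (Module R (LinearMap.ker g ⧸ (LinearMap.range f).submoduleOf (LinearMap.ker g)))

end

/-- The first homology `H₁(G; N(G)) = Tor₁^{ℂG}(N(G), ℂ)`, a left `N(G)`-module. -/
abbrev H₁ : Type _ := Homology (d₂ G) (d₁ G)

/-- The first `ℓ²`-Betti number of an arbitrary group `G`: the von Neumann dimension of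
`H₁(G; N(G))`. -/
def b₁ : ℝ≥0∞ := vnDim G (H₁ G)

/-- The limit inferior of the first `ℓ²`-Betti numbers of the finitely generated subgroups of `G`,
over the directed system of these subgroups. -/
def bBar₁ : ℝ≥0∞ :=
  Filter.liminf (fun H : {H : Subgroup G // H.FG} => b₁ H.1) Filter.atTop

end L2Betti

end

/-! The bound proved is `b₁ G ≤ 2`, and `2 ≤ 2p - 2`. `H₁ G` sits inside `M = C₁ / im d₂`, which is
spanned by the values of the derivation `D g = [g]`. It is enough to bound the dimension of
projective modules embedded in that span.

Exponent `p` enters through `0 = D(aᵖ) = (1 + a + ⋯ + aᵖ⁻¹) D a`. For `a = g h` this puts `(1 + gh +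
⋯ + (gh)ᵖ⁻¹) D g` in the span of `D h` (`powSum_smul_derivation`). Suppose infinitely many `h` have
`D h` in the span of a finite family `x`. Averaging the coefficient over `m` such `h` gives an
element within `p/√m` of `1` in the 2-norm, because `a ↦ aⁱ` is injective for `0 < i < p`. So every
`D g` is almost in the span of `x`, and the dimension is at most the size of `x`
(`trace_le_of_infinite`).

Such a family of size 2 exists unless `G` is locally finite. On a finite subgroup `K` all values of
`D` are multiples of `∑ D k`, so one element spans them. If `⟨K, g⟩` is infinite for some finite
`K`, then `∑ D k` and `D g` suffice; otherwise `G` is locally finite and the dimension is at most 1.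

"Almost in the span" becomes a dimension bound in `trace_le_of_annihilator`, a count of ranks of
equivariant operators on `ℓ²(G)ⁿ` that rests on `card_sub_hTrace_kerProj_le`. -/

open scoped ENNReal

noncomputable section

set_option linter.unusedSectionVars false

namespace L2Betti

open Filter Topology

/-! ### The trace on `N(G)` and its trace property. -/

section Trace

variable {G : Type*} [Group G]

open Classical in
/-- The cyclic and separating vector `δ₁` of `ℓ²(G)`. -/
def vac (G : Type*) [Group G] : ell2 G := delta (1 : G)

open Classical in
theorem delta_apply (g x : G) : (delta g : ell2 G) x = if x = g then 1 else 0 := by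
  rw [delta, lp.single_apply, Pi.single_apply]

theorem inner_vac_left (v : ell2 G) : inner ℂ (vac G) v = v 1 := by
  classical
  rw [vac, delta, lp.inner_single_left]
  simp

theorem vnTrace_eq_inner (a : VN G) : vnTrace a = inner ℂ (vac G) (a.op (vac G)) := rfl

theorem rightTranslation_apply (g x : G) (f : ell2 G) :
    rightTranslation g f x = f (x * g⁻¹) := rfl

theorem leftTranslation_apply (g x : G) (f : ell2 G) :
    leftTranslation g f x = f (g⁻¹ * x) := rfl

theorem op_rightTranslation (a : VN G) (g : G) (v : ell2 G) :
    a.op (rightTranslation g v) = rightTranslation g (a.op v) := by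
  have h : a.op ∈ groupVN G := a.2
  rw [groupVN, StarSubalgebra.mem_centralizer_iff] at h
  have := (h (rightTranslation g) ⟨g, rfl⟩).1
  exact (congrArg (fun T : ell2 G →L[ℂ] ell2 G => T v) this).symm

/-- An operator that commutes with the right translations, as an element of `N(G)`. -/
def VN.ofCommute (T : ell2 G →L[ℂ] ell2 G)
    (h : ∀ g v, T (rightTranslation g v) = rightTranslation g (T v)) : VN G :=
  ⟨T, by
    have key : ∀ g : G, rightTranslation g * T = T * rightTranslation g := fun g =>
      ContinuousLinearMap.ext fun v => (h g v).symm
    rw [groupVN, StarSubalgebra.mem_centralizer_iff]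
    rintro _ ⟨g, rfl⟩
    refine ⟨key g, ?_⟩
    rw [star_rightTranslation]
    exact key g⁻¹⟩

@[simp] theorem VN.op_ofCommute (T : ell2 G →L[ℂ] ell2 G) (h) : (VN.ofCommute T h).op = T := rfl

theorem VN.op_injective : Function.Injective (VN.op : VN G → _) := Subtype.coe_injective

/-- The inclusion of `N(G)` into the bounded operators on `ℓ²(G)`. -/
def VN.opHom (G : Type*) [Group G] : VN G →+* (ell2 G →L[ℂ] ell2 G) :=
  (groupVN G).subtype.toAlgHom.toRingHom

theorem VN.op_mul_apply (a b : VN G) (v : ell2 G) : (a * b).op v = a.op (b.op v) := rfl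
theorem VN.op_one : (1 : VN G).op = 1 := rfl
theorem VN.op_zero : (0 : VN G).op = 0 := rfl
theorem VN.op_sum {ι : Type*} (s : Finset ι) (f : ι → VN G) :
    (∑ i ∈ s, f i).op = ∑ i ∈ s, (f i).op := map_sum (VN.opHom G) f s

theorem op_incl (g : G) : (incl g).op = leftTranslation g := rfl

open Classical in
theorem rightTranslation_vac (g : G) : rightTranslation g (vac G) = delta g := by
  ext x
  rw [rightTranslation_apply, vac, delta_apply, delta_apply]
  simp [mul_inv_eq_one]

open Classical in
theorem leftTranslation_vac (g : G) : leftTranslation g (vac G) = delta g := by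
  ext x
  rw [leftTranslation_apply, vac, delta_apply, delta_apply]
  simp [inv_mul_eq_one, eq_comm]

open Classical in
theorem star_op_vac_apply (a : VN G) (g : G) :
    (star a.op) (vac G) g = starRingEnd ℂ (a.op (vac G) g⁻¹) := by
  have h1 : (star a.op) (vac G) g = inner ℂ (delta g) ((star a.op) (vac G)) := by
    rw [delta, lp.inner_single_left]; simp
  rw [h1, ContinuousLinearMap.star_eq_adjoint, ContinuousLinearMap.adjoint_inner_right,
    ← rightTranslation_vac g, op_rightTranslation, ← inner_conj_symm, inner_vac_left,
    rightTranslation_apply, one_mul]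

/-- Pairing the coefficients of `a δ₁` at `g⁻¹` with those of `b δ₁` at `g` makes the formula
symmetric under `g ↦ g⁻¹`, which yields `vnTrace_mul_comm`. -/
theorem vnTrace_mul (a b : VN G) :
    vnTrace (a * b) = ∑' g, a.op (vac G) g⁻¹ * b.op (vac G) g := by
  have : vnTrace (a * b) = inner ℂ ((star a.op) (vac G)) (b.op (vac G)) := by
    rw [ContinuousLinearMap.star_eq_adjoint, ContinuousLinearMap.adjoint_inner_left]
    rfl
  rw [this, lp.inner_eq_tsum]
  refine tsum_congr fun g => ?_
  rw [star_op_vac_apply, RCLike.inner_apply, starRingEnd_self_apply, mul_comm]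

theorem vnTrace_mul_comm (a b : VN G) : vnTrace (a * b) = vnTrace (b * a) := by
  rw [vnTrace_mul, vnTrace_mul, ← (Equiv.inv G).tsum_eq]
  refine tsum_congr fun g => ?_
  simp [mul_comm]

end Trace

/-! ### Equivariant operators on `ℓ²(G)ⁿ`, matrices over `N(G)` and their trace. -/

section HilbertModule

variable (G : Type*) [Group G]

/-- The Hilbert module `ℓ²(G)^ι`. -/
abbrev Hn (ι : Type*) [Fintype ι] : Type _ := PiLp 2 (fun _ : ι => ell2 G)

variable {G} {ι κ μ : Type*} [Fintype ι] [Fintype κ] [Fintype μ]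

/-- The right translation by `g` on `ℓ²(G)^ι`. -/
def rho (g : G) : Hn G ι ≃ₗᵢ[ℂ] Hn G ι :=
  LinearIsometryEquiv.piLpCongrRight 2 fun _ => permUnitary (Equiv.mulRight g)

theorem rho_apply (g : G) (v : Hn G ι) (i : ι) : rho g v i = rightTranslation g (v i) := rfl

theorem rho_single [DecidableEq ι] (g : G) (i : ι) (v : ell2 G) :
    rho g (PiLp.single 2 i v : Hn G ι) = PiLp.single 2 i (rightTranslation g v) :=
  LinearIsometryEquiv.piLpCongrRight_single _ _ _

theorem rho_symm (g : G) (v : Hn G ι) : (rho g).symm v = rho g⁻¹ v := by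
  rw [LinearIsometryEquiv.symm_apply_eq]
  ext i x
  rw [rho_apply, rho_apply, rightTranslation_apply, rightTranslation_apply]
  simp

/-- A bounded operator between Hilbert modules that commutes with right translations. -/
def Equivariant (T : Hn G κ →L[ℂ] Hn G ι) : Prop := ∀ g v, T (rho g v) = rho g (T v)

namespace Equivariant

theorem comp {S : Hn G κ →L[ℂ] Hn G ι} {T : Hn G μ →L[ℂ] Hn G κ}
    (hS : Equivariant S) (hT : Equivariant T) : Equivariant (S ∘L T) := fun g v => by
  rw [ContinuousLinearMap.comp_apply, hT, hS, ContinuousLinearMap.comp_apply]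

theorem add {S T : Hn G κ →L[ℂ] Hn G ι} (hS : Equivariant S) (hT : Equivariant T) :
    Equivariant (S + T) := fun g v => by
  rw [add_apply, hS, hT, add_apply, map_add]

theorem sub {S T : Hn G κ →L[ℂ] Hn G ι} (hS : Equivariant S) (hT : Equivariant T) :
    Equivariant (S - T) := fun g v => by
  rw [sub_apply, hS, hT, sub_apply, map_sub]

theorem smul {T : Hn G κ →L[ℂ] Hn G ι} (c : ℂ) (hT : Equivariant T) :
    Equivariant (c • T) := fun g v => by
  rw [smul_apply, hT, smul_apply, map_smul]

theorem one : Equivariant (1 : Hn G ι →L[ℂ] Hn G ι) := fun _ _ => rfl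

theorem adjoint {T : Hn G κ →L[ℂ] Hn G ι} (hT : Equivariant T) :
    Equivariant (ContinuousLinearMap.adjoint T) := fun g v => by
  refine ext_inner_right ℂ fun w => ?_
  rw [ContinuousLinearMap.adjoint_inner_left, ← LinearIsometryEquiv.inner_map_map (rho g).symm,
    LinearIsometryEquiv.symm_apply_apply, rho_symm, ← hT,
    ← ContinuousLinearMap.adjoint_inner_left, ← rho_symm,
    ← LinearIsometryEquiv.inner_map_map (rho g), LinearIsometryEquiv.apply_symm_apply]

theorem of_inverse {S T : Hn G ι →L[ℂ] Hn G ι} (hS : Equivariant S) (h1 : S ∘L T = 1)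
    (h2 : T ∘L S = 1) : Equivariant T := fun g v => by
  have e1 : ∀ w, S (T w) = w := fun w => congrArg (fun X : Hn G ι →L[ℂ] Hn G ι => X w) h1
  have e2 : ∀ w, T (S w) = w := fun w => congrArg (fun X : Hn G ι →L[ℂ] Hn G ι => X w) h2
  conv_lhs => rw [← e1 v, ← hS, e2]

theorem starProjection_ker {T : Hn G κ →L[ℂ] Hn G ι} (hT : Equivariant T) :
    Equivariant (LinearMap.ker T.toLinearMap).starProjection := fun g v => by
  set K := LinearMap.ker T.toLinearMap
  have hmem : ∀ (h : G) (w), w ∈ K → rho h w ∈ K := by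
    intro h w hw
    have hw' : T w = 0 := hw
    change T (rho h w) = 0
    rw [hT, hw', map_zero]
  change K.starProjection (rho g v) = rho g (K.starProjection v)
  apply Submodule.eq_starProjection_of_mem_of_inner_eq_zero
  · exact hmem g _ (Submodule.starProjection_apply_mem _ _)
  · intro w hw
    rw [← map_sub, ← LinearIsometryEquiv.inner_map_map (rho g).symm,
      LinearIsometryEquiv.symm_apply_apply, rho_symm]
    exact Submodule.inner_left_of_mem_orthogonal (hmem g⁻¹ w hw)
      (Submodule.sub_starProjection_mem_orthogonal v)

end Equivariant

variable [DecidableEq ι] [DecidableEq κ] [DecidableEq μ]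

/-- The inclusion of `ℓ²(G)` as the `j`-th summand. -/
def singleL (j : κ) : ell2 G →L[ℂ] Hn G κ :=
  LinearMap.mkContinuous
    { toFun := fun v => PiLp.single 2 j v
      map_add' := fun a b => PiLp.single_add 2 j
      map_smul' := fun c a => by ext i : 1; rcases eq_or_ne i j with rfl | h <;> simp [*] } 1
    (fun v => by simp)

theorem singleL_apply (j : κ) (v : ell2 G) : singleL j v = (PiLp.single 2 j v : Hn G κ) := rfl

theorem sum_single (v : Hn G κ) : ∑ j, (PiLp.single 2 j (v j) : Hn G κ) = v := by
  ext i : 1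
  rw [WithLp.ofLp_sum, Finset.sum_apply, Finset.sum_eq_single i]
  · simp
  · intro k _ hk
    rw [PiLp.single_eq_of_ne _ hk.symm]
  · simp

/-- The matrix entries of an equivariant operator. -/
def Equivariant.entry {T : Hn G κ →L[ℂ] Hn G ι} (hT : Equivariant T) (i : ι) (j : κ) : VN G :=
  VN.ofCommute ((PiLp.proj 2 (fun _ : ι => ell2 G) i : Hn G ι →L[ℂ] ell2 G) ∘L T ∘L singleL j)
    fun g v => by
      change T (PiLp.single 2 j (rightTranslation g v)) i
        = rightTranslation g (T (PiLp.single 2 j v) i)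
      rw [← rho_single, hT, rho_apply]

theorem Equivariant.op_entry {T : Hn G κ →L[ℂ] Hn G ι} (hT : Equivariant T) (i : ι) (j : κ)
    (v : ell2 G) : (hT.entry i j).op v = T (PiLp.single 2 j v) i := rfl

theorem Equivariant.apply_eq_sum {T : Hn G κ →L[ℂ] Hn G ι} (hT : Equivariant T) (v : Hn G κ)
    (i : ι) : T v i = ∑ j, (hT.entry i j).op (v j) := by
  conv_lhs => rw [← sum_single v, map_sum]
  simp [Equivariant.op_entry]

/-- The operator given by a matrix over `N(G)`. -/
def opMat (M : Matrix ι κ (VN G)) : Hn G κ →L[ℂ] Hn G ι :=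
  ∑ i, ∑ j, singleL i ∘L (M i j).op ∘L (PiLp.proj 2 (fun _ : κ => ell2 G) j : Hn G κ →L[ℂ] ell2 G)

theorem opMat_apply (M : Matrix ι κ (VN G)) (v : Hn G κ) (i : ι) :
    opMat M v i = ∑ j, (M i j).op (v j) := by
  have h : ∀ (k : ι) (w : ell2 G), (singleL k w : Hn G ι) i = if i = k then w else 0 := by
    intro k w
    rw [singleL_apply, PiLp.ofLp_single, Pi.single_apply]
  simp [opMat, h]

theorem opMat_single (M : Matrix ι κ (VN G)) (i : ι) (j : κ) (w : ell2 G) :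
    opMat M (PiLp.single 2 j w) i = (M i j).op w := by
  rw [opMat_apply, Finset.sum_eq_single j]
  · simp
  · intro k _ hk
    rw [PiLp.single_eq_of_ne _ hk, map_zero]
  · simp

theorem opMat_equivariant (M : Matrix ι κ (VN G)) : Equivariant (opMat M) := fun g v => by
  ext i : 1
  rw [opMat_apply, rho_apply, opMat_apply, map_sum]
  simp only [rho_apply, op_rightTranslation]

theorem opMat_mul (M : Matrix ι κ (VN G)) (N : Matrix κ μ (VN G)) :
    opMat (M * N) = opMat M ∘L opMat N := by
  ext v i : 2
  rw [ContinuousLinearMap.comp_apply, opMat_apply, opMat_apply]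
  simp only [opMat_apply, map_sum, Matrix.mul_apply, VN.op_sum, sum_apply,
    VN.op_mul_apply]
  exact Finset.sum_comm

/-- The basis vector `δ₁` in the `i`-th summand of `ℓ²(G)^ι`. -/
def bvec (i : ι) : Hn G ι := PiLp.single 2 i (vac G)

theorem norm_bvec (i : ι) : ‖(bvec i : Hn G ι)‖ = 1 := by
  classical
  rw [bvec, PiLp.norm_single, vac, delta, lp.norm_single (by norm_num)]
  simp

theorem inner_bvec_left (i : ι) (v : Hn G ι) : inner ℂ (bvec i) v = inner ℂ (vac G) (v i) := by
  rw [PiLp.inner_apply, Finset.sum_eq_single i]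
  · simp [bvec]
  · intro k _ hk
    rw [bvec, PiLp.single_eq_of_ne _ hk, inner_zero_left]
  · simp

/-- The von Neumann trace of an operator on `ℓ²(G)^ι`. -/
def hTrace (T : Hn G ι →L[ℂ] Hn G ι) : ℂ := ∑ i, inner ℂ (bvec i) (T (bvec i))

theorem hTrace_sub (S T : Hn G ι →L[ℂ] Hn G ι) : hTrace (S - T) = hTrace S - hTrace T := by
  simp [hTrace, Finset.sum_sub_distrib]

theorem hTrace_smul (c : ℂ) (T : Hn G ι →L[ℂ] Hn G ι) : hTrace (c • T) = c * hTrace T := by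
  simp [hTrace, Finset.mul_sum]

theorem hTrace_one : hTrace (1 : Hn G ι →L[ℂ] Hn G ι) = Fintype.card ι := by
  simp [hTrace, inner_self_eq_norm_sq_to_K, norm_bvec]

theorem hTrace_opMat (M : Matrix ι ι (VN G)) : hTrace (opMat M) = ∑ i, vnTrace (M i i) := by
  simp only [hTrace, inner_bvec_left, vnTrace_eq_inner]
  exact Finset.sum_congr rfl fun i _ => by rw [bvec, opMat_single]

theorem hTrace_comp {S : Hn G κ →L[ℂ] Hn G ι} {T : Hn G ι →L[ℂ] Hn G κ}
    (hS : Equivariant S) (hT : Equivariant T) :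
    hTrace (S ∘L T) = ∑ i, ∑ j, vnTrace (hS.entry i j * hT.entry j i) := by
  refine Finset.sum_congr rfl fun i _ => ?_
  rw [inner_bvec_left, ContinuousLinearMap.comp_apply, hS.apply_eq_sum, inner_sum]
  refine Finset.sum_congr rfl fun j _ => ?_
  rw [vnTrace_eq_inner, VN.op_mul_apply, hT.op_entry, bvec]

theorem hTrace_comp_comm {S : Hn G κ →L[ℂ] Hn G ι} {T : Hn G ι →L[ℂ] Hn G κ}
    (hS : Equivariant S) (hT : Equivariant T) : hTrace (S ∘L T) = hTrace (T ∘L S) := by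
  rw [hTrace_comp hS hT, hTrace_comp hT hS, Finset.sum_comm]
  simp only [vnTrace_mul_comm]

end HilbertModule

/-! ### The resolvent of `S* S` and the kernel projection as its limit. -/

section Resolvent

open ContinuousLinearMap

variable {E F : Type*} [NormedAddCommGroup E] [InnerProductSpace ℂ E] [CompleteSpace E]
  [NormedAddCommGroup F] [InnerProductSpace ℂ F] [CompleteSpace F]

theorem inner_gram (S : E →L[ℂ] F) (ε : ℝ) (y : E) :
    inner ℂ y ((adjoint S ∘L S + (ε : ℂ) • (1 : E →L[ℂ] E)) y)
      = ((‖S y‖ ^ 2 + ε * ‖y‖ ^ 2 : ℝ) : ℂ) := by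
  change inner ℂ y (adjoint S (S y) + (ε : ℂ) • y) = _
  rw [inner_add_right, adjoint_inner_right, inner_smul_right,
    inner_self_eq_norm_sq_to_K, inner_self_eq_norm_sq_to_K]
  push_cast
  rfl

theorem isUnit_gram (S : E →L[ℂ] F) {ε : ℝ} (hε : 0 < ε) :
    IsUnit (adjoint S ∘L S + (ε : ℂ) • (1 : E →L[ℂ] E)) := by
  refine isUnit_of_forall_le_norm_inner_map _ (c := ⟨ε, hε.le⟩) hε fun x => ?_
  rw [norm_inner_symm, inner_gram, Complex.norm_real, Real.norm_of_nonneg (by positivity)]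
  change ‖x‖ ^ 2 * ε ≤ _
  nlinarith [sq_nonneg ‖S x‖]

/-- The resolvent `(S* S + ε)⁻¹`. -/
def resolvent (S : E →L[ℂ] F) (ε : ℝ) : E →L[ℂ] E :=
  Ring.inverse (adjoint S ∘L S + (ε : ℂ) • (1 : E →L[ℂ] E))

theorem gram_comp_resolvent (S : E →L[ℂ] F) {ε : ℝ} (hε : 0 < ε) :
    (adjoint S ∘L S + (ε : ℂ) • (1 : E →L[ℂ] E)) ∘L resolvent S ε = 1 :=
  Ring.mul_inverse_cancel _ (isUnit_gram S hε)

theorem resolvent_comp_gram (S : E →L[ℂ] F) {ε : ℝ} (hε : 0 < ε) :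
    resolvent S ε ∘L (adjoint S ∘L S + (ε : ℂ) • (1 : E →L[ℂ] E)) = 1 :=
  Ring.inverse_mul_cancel _ (isUnit_gram S hε)

/-- Pair `(S* S + ε) y = x` with `y`. The norm bounds on the resolvent all come from this energy
identity. -/
theorem norm_sq_resolvent (S : E →L[ℂ] F) {ε : ℝ} (hε : 0 < ε) (x : E) :
    ‖S (resolvent S ε x)‖ ^ 2 + ε * ‖resolvent S ε x‖ ^ 2
      = (inner ℂ (resolvent S ε x) x).re := by
  have h := inner_gram S ε (resolvent S ε x)
  rw [← comp_apply, gram_comp_resolvent S hε] at h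
  exact (congrArg Complex.re h).symm

theorem resolvent_inner_nonneg (S : E →L[ℂ] F) {ε : ℝ} (hε : 0 < ε) (x : E) :
    0 ≤ (inner ℂ x (resolvent S ε x)).re := by
  rw [← RCLike.re_eq_complex_re, inner_re_symm, RCLike.re_eq_complex_re,
    ← norm_sq_resolvent S hε]
  positivity

theorem norm_smul_resolvent_le (S : E →L[ℂ] F) {ε : ℝ} (hε : 0 < ε) (x : E) :
    ε * ‖resolvent S ε x‖ ≤ ‖x‖ := by
  have h := norm_sq_resolvent S hε x
  have h2 : (inner ℂ (resolvent S ε x) x).re ≤ ‖resolvent S ε x‖ * ‖x‖ :=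
    re_inner_le_norm (𝕜 := ℂ) _ _
  rcases (norm_nonneg (resolvent S ε x)).eq_or_lt with h0 | h0
  · rw [← h0, mul_zero]; positivity
  · nlinarith [sq_nonneg ‖S (resolvent S ε x)‖]

theorem norm_smul_resolvent_adjoint_le (S : E →L[ℂ] F) {ε : ℝ} (hε : 0 < ε) (u : F) :
    (ε * ‖resolvent S ε (adjoint S u)‖) ^ 2 ≤ ε * ‖u‖ ^ 2 := by
  have h := norm_sq_resolvent S hε (adjoint S u)
  rw [adjoint_inner_right] at h
  have h2 : (inner ℂ (S (resolvent S ε (adjoint S u))) u).re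
      ≤ ‖S (resolvent S ε (adjoint S u))‖ * ‖u‖ := re_inner_le_norm (𝕜 := ℂ) _ _
  have h3 : ε * ‖resolvent S ε (adjoint S u)‖ ^ 2 ≤ ‖u‖ ^ 2 := by
    nlinarith [sq_nonneg (‖S (resolvent S ε (adjoint S u))‖ - ‖u‖ / 2), sq_nonneg ‖u‖]
  calc _ = ε * (ε * ‖resolvent S ε (adjoint S u)‖ ^ 2) := by ring
    _ ≤ _ := mul_le_mul_of_nonneg_left h3 hε.le

/-- The range of `S*` is dense in `(ker S)ᗮ`. On it `ε (S* S + ε)⁻¹` is of order `√ε`, and these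
operators are contractions, so the limit extends to the closure. -/
theorem tendsto_smul_resolvent_of_mem_orthogonal (S : E →L[ℂ] F) {x : E}
    (hx : x ∈ (LinearMap.ker S.toLinearMap)ᗮ) :
    Tendsto (fun ε : ℝ => (ε : ℂ) • resolvent S ε x) (𝓝[>] 0) (𝓝 0) := by
  rw [orthogonal_ker] at hx
  rw [Metric.tendsto_nhds]
  intro η hη
  obtain ⟨_, ⟨u, rfl⟩, hu⟩ := Metric.mem_closure_iff.1 hx (η / 2) (half_pos hη)
  have hlim : Tendsto (fun ε : ℝ => ε * ‖u‖ ^ 2) (𝓝[>] 0) (𝓝 0) := by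
    have : Tendsto (fun ε : ℝ => ε * ‖u‖ ^ 2) (𝓝 0) (𝓝 (0 * ‖u‖ ^ 2)) :=
      tendsto_id.mul_const _
    rw [zero_mul] at this
    exact this.mono_left nhdsWithin_le_nhds
  filter_upwards [self_mem_nhdsWithin, hlim.eventually_lt_const (u := (η / 2) ^ 2) (by positivity)]
    with ε hε h1
  have hε : 0 < ε := hε
  have h2 := norm_smul_resolvent_adjoint_le S hε u
  have h3 := norm_smul_resolvent_le S hε (x - adjoint S u)
  have h4 : ε * ‖resolvent S ε (adjoint S u)‖ < η / 2 :=
    lt_of_pow_lt_pow_left₀ 2 (by positivity) (h2.trans_lt h1)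
  have hu' : ‖x - adjoint S u‖ < η / 2 := by rw [← dist_eq_norm]; exact hu
  rw [dist_zero_right, norm_smul, Complex.norm_real, Real.norm_of_nonneg hε.le]
  have h5 : ‖resolvent S ε x‖
      ≤ ‖resolvent S ε (x - adjoint S u)‖ + ‖resolvent S ε (adjoint S u)‖ := by
    conv_lhs => rw [← sub_add_cancel x (adjoint S u), map_add]
    exact norm_add_le _ _
  nlinarith

theorem smul_resolvent_of_mem_ker (S : E →L[ℂ] F) {ε : ℝ} (hε : 0 < ε) {x : E} (hx : S x = 0) :
    (ε : ℂ) • resolvent S ε x = x := by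
  have h := congrArg (fun T : E →L[ℂ] E => T x) (resolvent_comp_gram S hε)
  simpa [hx] using h

theorem tendsto_smul_resolvent (S : E →L[ℂ] F) (x : E) :
    Tendsto (fun ε : ℝ => (ε : ℂ) • resolvent S ε x) (𝓝[>] 0)
      (𝓝 ((LinearMap.ker S.toLinearMap).starProjection x)) := by
  set K := LinearMap.ker S.toLinearMap
  have h := (tendsto_smul_resolvent_of_mem_orthogonal S
    (K.sub_starProjection_mem_orthogonal x)).const_add (K.starProjection x)
  rw [add_zero] at h
  refine h.congr' ?_
  filter_upwards [self_mem_nhdsWithin] with ε hε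
  have h0 : S (K.starProjection x) = 0 := K.starProjection_apply_mem x
  rw [map_sub, smul_sub, smul_resolvent_of_mem_ker S hε h0, add_sub_cancel]

end Resolvent

/-! ### Comparing the dimensions of coimage and range. -/

section Comparison

open ContinuousLinearMap

variable {G : Type*} [Group G] {ι κ : Type*} [Fintype ι] [Fintype κ]
  [DecidableEq ι] [DecidableEq κ]

theorem Equivariant.gram {S : Hn G κ →L[ℂ] Hn G ι} (hS : Equivariant S) (ε : ℝ) :
    Equivariant (ContinuousLinearMap.adjoint S ∘L S + (ε : ℂ) • (1 : Hn G κ →L[ℂ] Hn G κ)) :=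
  (hS.adjoint.comp hS).add (Equivariant.one.smul _)

theorem Equivariant.resolvent {S : Hn G κ →L[ℂ] Hn G ι} (hS : Equivariant S) {ε : ℝ}
    (hε : 0 < ε) : Equivariant (resolvent S ε) :=
  (hS.gram ε).of_inverse (gram_comp_resolvent S hε) (resolvent_comp_gram S hε)

/-- The orthogonal projection onto the kernel of an operator. -/
abbrev kerProj (S : Hn G κ →L[ℂ] Hn G ι) : Hn G κ →L[ℂ] Hn G κ :=
  (LinearMap.ker S.toLinearMap).starProjection

theorem Equivariant.kerProj {S : Hn G κ →L[ℂ] Hn G ι} (hS : Equivariant S) :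
    Equivariant (kerProj S) := hS.starProjection_ker

/-- If `E` is an orthogonal projection whose range contains that of `S`, then the dimension of the
orthogonal complement of `ker S` is at most the dimension of the range of `E`. -/
theorem card_sub_hTrace_kerProj_le {S : Hn G κ →L[ℂ] Hn G ι} (hS : Equivariant S)
    {E : Hn G ι →L[ℂ] Hn G ι} (hE : Equivariant E) (hsa : adjoint E = E) (hid : E ∘L E = E)
    (hES : E ∘L S = S) :
    (Fintype.card κ : ℝ) - (hTrace (kerProj S)).re ≤ (hTrace E).re := by
  have hlim : Tendsto (fun ε : ℝ => (Fintype.card κ : ℝ) - (hTrace ((ε : ℂ) • resolvent S ε)).re)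
      (𝓝[>] 0) (𝓝 ((Fintype.card κ : ℝ) - (hTrace (kerProj S)).re)) := by
    refine tendsto_const_nhds.sub ((Complex.continuous_re.tendsto _).comp ?_)
    refine tendsto_finsetSum _ fun i _ => ?_
    exact tendsto_const_nhds.inner (tendsto_smul_resolvent S (bvec i))
  refine le_of_tendsto hlim ?_
  filter_upwards [self_mem_nhdsWithin] with ε hε
  -- For fixed `ε` the inequality is a trace computation: with `A = (S* S + ε)⁻¹` and `B = (S S* +
  -- ε)⁻¹`, `tr(1 - εA) = tr(S* S A) = tr(B S S*) = tr E - ε tr(E B E)`, and the last trace is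
  -- nonnegative.
  have hε : 0 < ε := hε
  set S' := adjoint S
  set A := resolvent S ε
  set B := resolvent S' ε
  have hB : Equivariant B := hS.adjoint.resolvent hε
  have hSS : adjoint S' = S := adjoint_adjoint S
  have eA : ∀ x, S' (S (A x)) + (ε : ℂ) • A x = x := fun x =>
    congrArg (fun T : Hn G κ →L[ℂ] Hn G κ => T x) (gram_comp_resolvent S hε)
  have eB : ∀ x, B (S (S' x)) + (ε : ℂ) • B x = x := fun x => by
    have := congrArg (fun T : Hn G ι →L[ℂ] Hn G ι => T x) (resolvent_comp_gram S' hε)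
    change B (adjoint S' (S' x) + (ε : ℂ) • x) = x at this
    rwa [hSS, map_add, map_smul] at this
  -- Intertwining: `S (S* S + ε) = (S S* + ε) S`.
  have eAB : S ∘L A = B ∘L S := by
    ext1 x
    have h1 := eB (S (A x))
    rw [← map_smul, ← map_add, ← map_smul, ← map_add, eA] at h1
    exact h1.symm
  have hSE : S' ∘L E = S' := by
    rw [← hsa, ← adjoint_comp, hES]
  have t1 : hTrace (S' ∘L S ∘L A) = hTrace ((B ∘L S) ∘L S') := by
    rw [eAB, hTrace_comp_comm hS.adjoint (hB.comp hS)]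
  have t2 : (B ∘L S) ∘L S' = E - (ε : ℂ) • (B ∘L E) := by
    ext1 x
    have hx : S' (E x) = S' x := congrArg (fun T : Hn G ι →L[ℂ] Hn G κ => T x) hSE
    change B (S (S' x)) = E x - (ε : ℂ) • B (E x)
    rw [eq_sub_iff_add_eq, ← hx, eB]
  have t3 : hTrace (B ∘L E) = hTrace (E ∘L B ∘L E) := by
    rw [hTrace_comp_comm hE (hB.comp hE), comp_assoc, hid]
  have t4 : 0 ≤ (hTrace (E ∘L B ∘L E)).re := by
    rw [hTrace, Complex.re_sum]
    refine Finset.sum_nonneg fun i _ => ?_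
    rw [comp_apply, ← adjoint_inner_left, hsa]
    exact resolvent_inner_nonneg S' hε _
  have t5 : (1 : Hn G κ →L[ℂ] Hn G κ) - (ε : ℂ) • A = S' ∘L S ∘L A := by
    ext1 x
    exact sub_eq_of_eq_add (eA x).symm
  have t6 : (Fintype.card κ : ℝ) - (hTrace ((ε : ℂ) • A)).re = (hTrace (S' ∘L S ∘L A)).re := by
    rw [← t5, hTrace_sub, hTrace_one]; simp
  rw [t6, t1, t2, hTrace_sub, hTrace_smul, t3, Complex.sub_re, Complex.re_ofReal_mul]
  nlinarith

end Comparison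

/-! ### Bounding a trace by approximate ranks. -/

section Rank

open ContinuousLinearMap

variable {G : Type*} [Group G] {ι κ : Type*} [Fintype ι] [Fintype κ]
  [DecidableEq ι] [DecidableEq κ]

theorem adjoint_kerProj (S : Hn G κ →L[ℂ] Hn G ι) : adjoint (kerProj S) = kerProj S :=
  isSelfAdjoint_starProjection _

theorem apply_kerProj (S : Hn G κ →L[ℂ] Hn G ι) (v : Hn G κ) : S (kerProj S v) = 0 :=
  (LinearMap.ker S.toLinearMap).starProjection_apply_mem v

theorem kerProj_of_mem {S : Hn G κ →L[ℂ] Hn G ι} {v : Hn G κ} (hv : S v = 0) :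
    kerProj S v = v :=
  Submodule.starProjection_eq_self_iff.2 hv

theorem kerProj_eq_zero {S : Hn G κ →L[ℂ] Hn G ι} {v : Hn G κ}
    (hv : ∀ w, S w = 0 → inner ℂ w v = 0) : kerProj S v = 0 := by
  rw [Submodule.starProjection_apply_eq_zero_iff, Submodule.mem_orthogonal]
  exact fun u hu => hv u hu

theorem hTrace_kerProj (S : Hn G κ →L[ℂ] Hn G ι) :
    (hTrace (kerProj S)).re = ∑ i, ‖kerProj S (bvec i)‖ ^ 2 := by
  rw [hTrace, Complex.re_sum]
  refine Finset.sum_congr rfl fun i _ => ?_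
  conv_lhs => rw [← kerProj_of_mem (apply_kerProj S (bvec i)), ← adjoint_inner_left,
    adjoint_kerProj, inner_self_eq_norm_sq_to_K]
  norm_cast

theorem norm_kerProj_le (S : Hn G κ →L[ℂ] Hn G ι) (v : Hn G κ) : ‖kerProj S v‖ ≤ ‖v‖ :=
  Submodule.norm_starProjection_apply_le _ v

/-- The projection of `ℓ²(G)^ι` onto the summands with index in `s`. -/
def coordProj (G : Type*) [Group G] (s : Finset ι) : Hn G ι →L[ℂ] Hn G ι :=
  opMat (Matrix.diagonal fun i => if i ∈ s then 1 else 0)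

theorem coordProj_apply (s : Finset ι) (v : Hn G ι) (i : ι) :
    coordProj G s v i = if i ∈ s then v i else 0 := by
  rw [coordProj, opMat_apply, Finset.sum_eq_single i]
  · rw [Matrix.diagonal_apply_eq]
    split_ifs <;> rfl
  · intro k _ hk
    rw [Matrix.diagonal_apply_ne _ hk.symm]
    rfl
  · simp

theorem inner_coordProj (s : Finset ι) (v w : Hn G ι) :
    inner ℂ (coordProj G s v) w = inner ℂ v (coordProj G s w) := by
  rw [PiLp.inner_apply, PiLp.inner_apply]
  refine Finset.sum_congr rfl fun i _ => ?_
  rw [coordProj_apply, coordProj_apply]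
  split_ifs <;> simp

/-- The rows of an equivariant operator are row vectors over `N(G)`. This turns the algebraic
annihilator hypothesis below into a statement about Hilbert space operators. -/
theorem comp_opMat_eq_zero {T : Hn G ι →L[ℂ] Hn G ι} (hT : Equivariant T)
    (M : Matrix ι κ (VN G)) :
    (∀ v, T (opMat M v) = 0) ↔ ∀ i j, ∑ k, hT.entry i k * M k j = 0 := by
  have key : ∀ i j w, (∑ k, hT.entry i k * M k j).op w
      = T (opMat M (PiLp.single 2 j w)) i := by
    intro i j w
    rw [hT.apply_eq_sum, VN.op_sum, sum_apply]
    refine Finset.sum_congr rfl fun k _ => ?_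
    rw [VN.op_mul_apply, opMat_single]
  constructor
  · intro h i j
    apply VN.op_injective
    ext1 w
    rw [key, h]
    rfl
  · intro h v
    rw [← sum_single v, map_sum, map_sum]
    refine Finset.sum_eq_zero fun j _ => ?_
    ext1 i
    rw [← key, h]
    rfl

/-- If every row vector annihilating `B` annihilates the idempotent `A`, then the trace of `A` is
bounded by the number of columns of `B`, diminished by the approximate rank of the block of rows
of `B` on which `A` vanishes. -/
theorem trace_le_of_annihilator {A : Matrix ι ι (VN G)} (hA : A * A = A) (s : Finset ι)
    (hs : ∀ i ∈ s, ∀ j, A i j = 0) (B : Matrix ι κ (VN G))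
    (hB : ∀ q : ι → VN G, (∀ j, ∑ i, q i * B i j = 0) → ∀ j, ∑ i, q i * A i j = 0)
    (f : ι → Hn G κ) {δ : ℝ}
    (hf : ∑ i ∈ s, ‖bvec i - coordProj G s (opMat B (f i))‖ ^ 2 ≤ δ) :
    (∑ i, vnTrace (A i i)).re ≤ Fintype.card κ - s.card + δ := by
  set a := opMat A with ha
  set b := opMat B with hb
  set D := coordProj G s with hD
  have haa : ∀ v, a (a v) = a v := fun v => by
    rw [ha, ← comp_apply, ← opMat_mul, hA]
  have ea : Equivariant a := opMat_equivariant A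
  have eb : Equivariant b := opMat_equivariant B
  have eD : Equivariant D := opMat_equivariant _
  set P := kerProj (1 - a) with hP
  set Q := kerProj (adjoint b) with hQ
  have eP : Equivariant P := (Equivariant.one.sub ea).kerProj
  have eQ : Equivariant Q := eb.adjoint.kerProj
  have sP : adjoint P = P := adjoint_kerProj _
  have sQ : adjoint Q = Q := adjoint_kerProj _
  have PP : ∀ v, P (P v) = P v := fun v => kerProj_of_mem (apply_kerProj _ v)
  have QQ : ∀ v, Q (Q v) = Q v := fun v => kerProj_of_mem (apply_kerProj _ v)
  have aP : ∀ v, a (P v) = P v := fun v => (sub_eq_zero.1 (apply_kerProj (1 - a) v)).symm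
  have Pa : ∀ v, P (a v) = a v := fun v => kerProj_of_mem (sub_eq_zero.2 (haa v).symm)
  have Qb : ∀ v, Q (b v) = 0 := fun v => kerProj_eq_zero fun w hw => by
    rw [← adjoint_inner_left, hw, inner_zero_left]
  -- The rows of `Q` annihilate `B`, hence `A`: the range of `a` lies in the closure of the range of
  -- `b`.
  have Qa : ∀ v, Q (a v) = 0 :=
    (comp_opMat_eq_zero eQ A).2 fun i => hB _ fun j => (comp_opMat_eq_zero eQ B).1 Qb i j
  have QP : ∀ v, Q (P v) = 0 := fun v => by rw [← aP, Qa]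
  have PQ : ∀ v, P (Q v) = 0 := fun v => by
    refine ext_inner_right ℂ fun w => ?_
    rw [← sP, adjoint_inner_left, ← sQ, adjoint_inner_left, QP, inner_zero_right, inner_zero_left]
  have Da : ∀ v, D (a v) = 0 := fun v => by
    ext1 i
    rw [hD, coordProj_apply]
    split_ifs with hi
    · rw [ha, opMat_apply]
      exact Finset.sum_eq_zero fun j _ => by rw [hs i hi]; rfl
    · rfl
  have DP : ∀ v, D (P v) = 0 := fun v => by rw [← aP, Da]
  have trP : hTrace P = hTrace a := by
    have h1 : a ∘L P = P := by ext1 v; exact aP v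
    have h2 : P ∘L a = a := by ext1 v; exact Pa v
    rw [← h1, hTrace_comp_comm ea eP, h2]
  -- Projection onto the part of the closure of the range of `b` orthogonal to the range of `a`. Its
  -- trace is at most `|κ| - tr A` by `c2`, and at least `|s| - δ` by `c1` and `c3`.
  set E : Hn G ι →L[ℂ] Hn G ι := 1 - Q - P with hE
  have eE : Equivariant E := (Equivariant.one.sub eQ).sub eP
  have E_apply : ∀ v, E v = v - Q v - P v := fun v => rfl
  have sE : adjoint E = E := by
    rw [hE, map_sub, map_sub, sP, sQ]
    congr 2
    exact adjoint_id
  have EE : E ∘L E = E := by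
    ext1 v
    rw [comp_apply, E_apply, E_apply, map_sub, map_sub, map_sub, map_sub, QQ, QP, PP, PQ]
    abel
  set S := E ∘L D with hS
  have ES : E ∘L S = S := by rw [hS, ← comp_assoc, EE]
  have c1 := card_sub_hTrace_kerProj_le (eE.comp eD) eE sE EE ES
  have c2 := card_sub_hTrace_kerProj_le eb.adjoint Equivariant.one adjoint_id (id_comp _)
    (id_comp _)
  rw [hE, hTrace_sub, hTrace_sub, hTrace_one, trP, ha, hTrace_opMat, Complex.sub_re,
    Complex.sub_re, Complex.natCast_re] at c1
  rw [hTrace_one, Complex.natCast_re] at c2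
  have c3 : (hTrace (kerProj S)).re ≤ Fintype.card ι - s.card + δ := by
    -- `ker S` is orthogonal to the range of `D b`, which nearly contains `bvec i` for `i ∈ s`.
    -- These vectors add at most `δ` to the trace of `kerProj S`, all others at most 1 each.
    have hker : ∀ v, kerProj S (D (b v)) = 0 := fun v => kerProj_eq_zero fun w hw => by
      have h1 : D w = Q (D w) + P (D w) := by
        have : E (D w) = 0 := hw
        rw [E_apply, sub_sub, sub_eq_zero] at this
        exact this
      rw [hD, ← inner_coordProj, ← hD, h1, inner_add_left, ← sQ, adjoint_inner_left, Qb,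
        inner_zero_right, zero_add, ← sP, adjoint_inner_left, hD, inner_coordProj, ← hD, DP,
        inner_zero_right]
    rw [hTrace_kerProj, ← Finset.sum_add_sum_compl s, add_comm,
      ← Nat.cast_sub (Finset.card_le_univ s), ← Finset.card_compl]
    refine add_le_add ?_ (le_trans (Finset.sum_le_sum fun i _ => ?_) hf)
    · rw [← nsmul_one, ← Finset.sum_const]
      refine Finset.sum_le_sum fun i _ => ?_
      have := norm_kerProj_le S (bvec i)
      rw [norm_bvec] at this
      exact pow_le_one₀ (norm_nonneg _) this
    · have h1 : kerProj S (bvec i) = kerProj S (bvec i - D (b (f i))) := by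
        rw [map_sub, hker, sub_zero]
      rw [h1]
      exact pow_le_pow_left₀ (norm_nonneg _) (norm_kerProj_le S _) 2
  linarith

end Rank

variable {G : Type*} [Group G]

/-! ### From approximate generators to a dimension bound. -/

section Module

variable {M : Type*} [AddCommGroup M] [Module (VN G) M]

/-- If the elements `y e` are almost annihilated, by elements close to `1`, modulo the span of a finite family `x`, then a
finitely generated projective module embedded in the span of `y` has dimension at most the size
of `x`, up to the error measured by `δ`. -/
theorem trace_le_of_mem_span {n : ℕ} {A : Matrix (Fin n) (Fin n) (VN G)} (hA : A * A = A)
    {ε κ : Type*} [Fintype ε] [Fintype κ] [DecidableEq ε] [DecidableEq κ]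
    (y : ε → M) (x : κ → M) (V : ε → VN G)
    (hV : ∀ e, V e • y e ∈ Submodule.span (VN G) (Set.range x))
    (w : Fin n → M) (hw : ∀ i, w i ∈ Submodule.span (VN G) (Set.range y))
    (hwA : ∀ v : Fin n → VN G, ∑ i, v i • w i = 0 → ∀ j, ∑ i, v i * A i j = 0)
    (c : ℂ) {δ : ℝ} (hδ : ∑ e, ‖vac G - c • (V e).op (vac G)‖ ^ 2 ≤ δ) :
    (∑ i, vnTrace (A i i)).re ≤ Fintype.card κ + δ := by
  simp only [Submodule.mem_span_range_iff_exists_fun] at hV hw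
  choose C hC using hV
  choose Y hY using hw
  set s : Finset (Fin n ⊕ ε) := Finset.univ.map Function.Embedding.inr with hs
  have hinr : ∀ e, Sum.inr e ∈ s := fun e => by simp [hs]
  have hinl : ∀ i, Sum.inl i ∉ s := fun i => by simp [hs]
  set A' : Matrix (Fin n ⊕ ε) (Fin n ⊕ ε) (VN G) := Matrix.fromBlocks A 0 0 0
  -- The upper rows write `w` in terms of `y`, the lower rows encode `V e • y e - ∑ C e k • x k =
  -- 0`. If `q` annihilates `B`, the combination of the `w i` with coefficients `q (inl i)`
  -- vanishes. The `|ε|` extra columns are paid for by the `|ε|` rows in `s`.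
  set B : Matrix (Fin n ⊕ ε) (ε ⊕ κ) (VN G) :=
    Matrix.fromBlocks (Matrix.of Y) 0 (Matrix.diagonal V) (-Matrix.of C)
  have key := trace_le_of_annihilator (A := A') (by simp [A', Matrix.fromBlocks_multiply, hA]) s
    (by
      rintro (i | e) hi j
      · exact absurd hi (hinl i)
      · rcases j with j | j <;> rfl) B
    (by
      intro q hq
      have h1 : ∀ e, ∑ i, q (Sum.inl i) * Y i e = -(q (Sum.inr e) * V e) := fun e => by
        have := hq (Sum.inl e)
        simp only [B, Fintype.sum_sum_type, Matrix.fromBlocks_apply₁₁, Matrix.of_apply,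
          Matrix.fromBlocks_apply₂₁] at this
        rw [Finset.sum_eq_single (s := Finset.univ (α := ε)) e, Matrix.diagonal_apply_eq] at this
        · exact eq_neg_of_add_eq_zero_left this
        · intro k _ hk
          rw [Matrix.diagonal_apply_ne _ hk, mul_zero]
        · simp
      have h2 : ∀ k, ∑ e, q (Sum.inr e) * C e k = 0 := fun k => by
        simpa [B] using hq (Sum.inr k)
      have h3 : ∑ i, q (Sum.inl i) • w i = 0 := by
        calc ∑ i, q (Sum.inl i) • w i
            = ∑ i, ∑ e, (q (Sum.inl i) * Y i e) • y e :=
              Finset.sum_congr rfl fun i _ => by simp only [← hY i, Finset.smul_sum, mul_smul]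
          _ = ∑ e, (∑ i, q (Sum.inl i) * Y i e) • y e := by
              rw [Finset.sum_comm]; simp only [Finset.sum_smul]
          _ = -∑ e, ∑ k, (q (Sum.inr e) * C e k) • x k := by
              rw [← Finset.sum_neg_distrib]
              refine Finset.sum_congr rfl fun e _ => ?_
              simp only [h1, neg_smul, mul_smul, ← Finset.smul_sum, hC]
          _ = 0 := by
              rw [Finset.sum_comm]
              simp only [← Finset.sum_smul, h2, zero_smul, Finset.sum_const_zero, neg_zero]
      have h4 := hwA _ h3
      rintro (j | j)
      · simpa [A'] using h4 j
      · simp [A'])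
    (fun i => Sum.elim (fun _ => 0) (fun e => c • PiLp.single 2 (Sum.inl e) (vac G)) i)
    (δ := δ) (by
      rw [hs, Finset.sum_map]
      refine le_trans (le_of_eq (Finset.sum_congr rfl fun e _ => ?_)) hδ
      congr 1
      rw [← PiLp.norm_single 2 (fun _ : Fin n ⊕ ε => ell2 G) (Sum.inr e)]
      congr 1
      change bvec (Sum.inr e) - coordProj G s (opMat B (c • PiLp.single 2 (Sum.inl e) (vac G))) = _
      ext1 i
      rw [map_smul, map_smul, PiLp.sub_apply, PiLp.smul_apply, coordProj_apply, opMat_single]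
      rcases i with i | e'
      · rw [if_neg (hinl i), bvec, PiLp.single_eq_of_ne _ (by simp),
          PiLp.single_eq_of_ne _ (by simp), smul_zero, sub_zero]
      · rw [if_pos (hinr e'), bvec]
        change _ - c • (Matrix.diagonal V e' e).op (vac G) = _
        rcases eq_or_ne e' e with rfl | he
        · rw [PiLp.single_eq_same, PiLp.single_eq_same, Matrix.diagonal_apply_eq]
        · rw [PiLp.single_eq_of_ne _ (by simpa using he), PiLp.single_eq_of_ne _ (by simpa using he),
            Matrix.diagonal_apply_ne _ he, VN.op_zero, zero_apply, smul_zero, sub_zero])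
  have hcard : s.card = Fintype.card ε := by rw [hs, Finset.card_map, Finset.card_univ]
  rw [hcard, Fintype.card_sum, Fintype.sum_sum_type] at key
  have hz : ∑ e, vnTrace (A' (Sum.inr e) (Sum.inr e)) = 0 := Finset.sum_eq_zero fun e _ => by
    change vnTrace (0 : VN G) = 0
    rw [vnTrace_eq_inner, VN.op_zero, zero_apply, inner_zero_right]
  rw [hz, add_zero] at key
  push_cast at key
  have : ∑ i, vnTrace (A i i) = ∑ i, vnTrace (A' (Sum.inl i) (Sum.inl i)) := rfl
  rw [this]
  linarith

end Module

/-! ### Averages of `1 + a + ⋯ + aᵖ⁻¹` in the 2-norm. -/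

section Averages

/-- The element `1 + a + ⋯ + a^(n-1)` of `N(G)`. -/
def powSum (n : ℕ) (a : G) : VN G := ∑ i ∈ Finset.range n, incl (a ^ i)

open Classical in
theorem norm_sum_delta_sq {m : ℕ} {φ : Fin m → G} (hφ : Function.Injective φ) :
    ‖∑ j, (delta (φ j) : ell2 G)‖ ^ 2 = m := by
  have h : inner ℂ (∑ j, (delta (φ j) : ell2 G)) (∑ j, (delta (φ j) : ell2 G)) = (m : ℂ) := by
    have h1 : ∀ j k, inner ℂ (delta (φ j) : ell2 G) (delta (φ k)) = if j = k then 1 else 0 := by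
      intro j k
      rw [delta, lp.inner_single_left, delta_apply]
      simp [hφ.eq_iff]
    simp only [sum_inner, inner_sum, h1]
    simp
  rw [← inner_self_eq_norm_sq (𝕜 := ℂ), h]
  simp

theorem pow_injective_of_exponent {p : ℕ} (hp : p.Prime) (hG : ∀ g : G, g ^ p = 1) {i : ℕ}
    (hi : 0 < i) (hip : i < p) : Function.Injective fun g : G => g ^ i := by
  obtain ⟨k, -, hk⟩ := Nat.exists_mul_mod_eq_one_of_coprime
    (Nat.coprime_of_lt_prime hi.ne' hip hp).symm hp.one_lt
  have h : ∀ x : G, (x ^ i) ^ k = x := fun x => by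
    rw [← pow_mul, pow_eq_pow_mod _ (hG x), hk, pow_one]
  intro a b hab
  rw [← h a, ← h b]
  exact congrArg (· ^ k) hab

/-- Averages of the elements `1 + g hⱼ + ⋯ + (g hⱼ)^(p-1)` are close to `1` in `2`-norm. -/
theorem norm_vac_sub_average_le {p : ℕ} (hp : p.Prime) (hG : ∀ g : G, g ^ p = 1) (g : G) {m : ℕ}
    (hm : 0 < m) {h : Fin m → G} (hh : Function.Injective h) :
    ‖vac G - ((m : ℂ)⁻¹) • (∑ j, powSum p (g * h j)).op (vac G)‖ ^ 2 ≤ (p : ℝ) ^ 2 / m := by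
  classical
  obtain ⟨r, rfl⟩ : ∃ r, p = r + 1 := ⟨p - 1, (Nat.succ_pred_prime hp).symm⟩
  have hm0 : (m : ℂ) ≠ 0 := by exact_mod_cast hm.ne'
  -- The zeroth powers contribute `m δ₁`. Each of the other `r = p - 1` powers contributes `m`
  -- distinct basis vectors, of total norm `√m`.
  have h1 : (∑ j, powSum (r + 1) (g * h j)).op (vac G)
      = (∑ i ∈ Finset.range r, ∑ j, delta ((g * h j) ^ (i + 1))) + (m : ℂ) • vac G := by
    simp only [powSum, VN.op_sum, sum_apply, op_incl, leftTranslation_vac]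
    simp only [Finset.sum_range_succ', Finset.sum_add_distrib, pow_zero]
    rw [Finset.sum_comm]
    simp [vac, Nat.cast_smul_eq_nsmul]
  have h2 : ∀ i ∈ Finset.range r, ‖∑ j, (delta ((g * h j) ^ (i + 1)) : ell2 G)‖ = √m := by
    intro i hi
    have hinj : Function.Injective fun j => (g * h j) ^ (i + 1) :=
      (pow_injective_of_exponent hp hG i.succ_pos
        (Nat.succ_lt_succ (Finset.mem_range.1 hi))).comp ((mul_right_injective g).comp hh)
    rw [← norm_sum_delta_sq hinj, Real.sqrt_sq (norm_nonneg _)]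
  have h3 : ‖∑ i ∈ Finset.range r, ∑ j, (delta ((g * h j) ^ (i + 1)) : ell2 G)‖ ≤ r * √m := by
    refine (norm_sum_le _ _).trans ?_
    rw [Finset.sum_congr rfl h2, Finset.sum_const, Finset.card_range, nsmul_eq_mul]
  rw [h1, smul_add, smul_smul, inv_mul_cancel₀ hm0, one_smul, sub_add_cancel_right, norm_neg,
    norm_smul, mul_pow, norm_inv, Complex.norm_natCast]
  have hm' : (0 : ℝ) < m := by exact_mod_cast hm
  calc ((m : ℝ)⁻¹) ^ 2 * ‖∑ i ∈ Finset.range r, ∑ j, (delta ((g * h j) ^ (i + 1)) : ell2 G)‖ ^ 2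
      ≤ ((m : ℝ)⁻¹) ^ 2 * (r * √m) ^ 2 := by gcongr
    _ = (r : ℝ) ^ 2 / m := by
        rw [mul_pow, Real.sq_sqrt hm'.le]; field_simp
    _ ≤ _ := by gcongr; simp

end Averages

/-! ### Derivations on a group of exponent `p`. -/

section Derivation

variable {M : Type*} [AddCommGroup M] [Module (VN G) M] {D : G → M}
  (hD : ∀ g h, D (g * h) = D g + incl g • D h)

include hD

theorem derivation_one : D 1 = 0 := by
  have := hD 1 1
  rwa [mul_one, incl_one, one_smul, left_eq_add] at this

theorem derivation_pow (a : G) (n : ℕ) : D (a ^ n) = powSum n a • D a := by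
  induction n with
  | zero => simp [powSum, derivation_one hD]
  | succ n ih => rw [pow_succ, hD, ih, powSum, powSum, Finset.sum_range_succ, add_smul]

/-- Expand `0 = D((gh)ᵖ) = powSum p (gh) • (D g + g • D h)`. -/
theorem powSum_smul_derivation {p : ℕ} (hG : ∀ g : G, g ^ p = 1) (g h : G) :
    powSum p (g * h) • D g = -(powSum p (g * h) * incl g) • D h := by
  have h1 := derivation_pow hD (g * h) p
  rw [hG, derivation_one hD, hD, smul_add, smul_smul] at h1
  rw [neg_smul]
  exact eq_neg_of_add_eq_zero_left h1.symm

/-- The elements whose images under a derivation lie in a fixed submodule form a subgroup. -/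
theorem derivation_mem_of_mem_closure (N : Submodule (VN G) M) {s : Set G}
    (hs : ∀ g ∈ s, D g ∈ N) {g : G} (hg : g ∈ Subgroup.closure s) : D g ∈ N := by
  induction hg using Subgroup.closure_induction with
  | mem x hx => exact hs x hx
  | one => rw [derivation_one hD]; exact N.zero_mem
  | mul x y _ _ hx hy => rw [hD]; exact N.add_mem hx (N.smul_mem _ hy)
  | inv x _ hx =>
    have h := hD x⁻¹ x
    rw [inv_mul_cancel, derivation_one hD] at h
    rw [eq_neg_of_add_eq_zero_left h.symm]
    exact N.neg_mem (N.smul_mem _ hx)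

/-- Summing `h • D k = D (h k) - D h` over `k ∈ K` gives `(1 - h) • ∑ D k = |K| • D h`, and `|K|` is
invertible in `N(G)`. -/
theorem derivation_mem_span_of_finite (K : Subgroup G) [Fintype K] {h : G} (hh : h ∈ K) :
    D h ∈ Submodule.span (VN G) {∑ k : K, D k} := by
  have hne : (Fintype.card K : ℂ) ≠ 0 := by exact_mod_cast Fintype.card_ne_zero
  set c : VN G := VN.ofCommute ((Fintype.card K : ℂ)⁻¹ • (1 : ell2 G →L[ℂ] ell2 G))
    (fun g v => (map_smul (rightTranslation g) _ v).symm)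
  have hc : c * (Fintype.card K : VN G) = 1 := by
    apply VN.op_injective
    ext1 v
    have h1 : (Fintype.card K : VN G).op = (Fintype.card K : ell2 G →L[ℂ] ell2 G) :=
      map_natCast (VN.opHom G) _
    have h2 : (Fintype.card K : VN G).op v = (Fintype.card K : ℂ) • v := by
      rw [h1, ← nsmul_one, Nat.cast_smul_eq_nsmul]
      rfl
    change (Fintype.card K : ℂ)⁻¹ • ((Fintype.card K : VN G).op v) = v
    rw [h2, smul_smul, inv_mul_cancel₀ hne, one_smul]
  have h1 : (1 - incl h) • ∑ k : K, D k = (Fintype.card K : VN G) • D h := by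
    have h2 : ∑ k : K, incl h • D k = ∑ k : K, D k - (Fintype.card K : VN G) • D h := by
      have h3 : ∀ k : K, incl h • D k = D ((⟨h, hh⟩ * k : K) : G) - D h := fun k => by
        rw [Subgroup.coe_mul, hD, add_sub_cancel_left]
      simp only [h3, Finset.sum_sub_distrib, Finset.sum_const, Finset.card_univ]
      rw [Nat.cast_smul_eq_nsmul]
      congr 1
      exact Equiv.sum_comp (Equiv.mulLeft (⟨h, hh⟩ : K)) fun k : K => D k
    rw [sub_smul, one_smul, Finset.smul_sum, h2, sub_sub_cancel]
  rw [Submodule.mem_span_singleton]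
  exact ⟨c * (1 - incl h), by rw [mul_smul, h1, smul_smul, hc, one_smul]⟩

omit hD in
theorem exists_finset_mem_span {n : ℕ} {w : Fin n → M}
    (hw : ∀ i, w i ∈ Submodule.span (VN G) (Set.range D)) :
    ∃ s : Finset G, ∀ i, w i ∈ Submodule.span (VN G) (D '' s) := by
  classical
  have : ∀ i, ∃ s : Finset G, w i ∈ Submodule.span (VN G) (D '' s) := fun i => by
    obtain ⟨T, hT, hwT⟩ := Submodule.mem_span_finite_of_mem_span (hw i)
    obtain ⟨s, -, rfl⟩ := Finset.subset_set_image_iff.1 (Set.image_univ ▸ hT)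
    exact ⟨s, by simpa using hwT⟩
  choose s hs using this
  exact ⟨Finset.univ.biUnion s, fun i => Submodule.span_mono
    (Set.image_mono (by exact_mod_cast Finset.subset_biUnion_of_mem s (Finset.mem_univ i))) (hs i)⟩

theorem trace_le_of_infinite {p : ℕ} (hp : p.Prime) (hG : ∀ g : G, g ^ p = 1)
    {κ : Type*} [Fintype κ] [DecidableEq κ] (x : κ → M) {S : Set G} (hS : S.Infinite)
    (hx : ∀ h ∈ S, D h ∈ Submodule.span (VN G) (Set.range x))
    {n : ℕ} {A : Matrix (Fin n) (Fin n) (VN G)} (hA : A * A = A) (w : Fin n → M)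
    (hw : ∀ i, w i ∈ Submodule.span (VN G) (Set.range D))
    (hwA : ∀ v : Fin n → VN G, ∑ i, v i • w i = 0 → ∀ j, ∑ i, v i * A i j = 0) :
    (∑ i, vnTrace (A i i)).re ≤ Fintype.card κ := by
  classical
  obtain ⟨s, hs⟩ := exists_finset_mem_span hw
  refine le_of_forall_pos_le_add fun η hη => ?_
  -- Each of the `|s|` generators costs an error `p² / m`; this `m` keeps the sum below `η`.
  obtain ⟨m, hm⟩ := exists_nat_gt (s.card * (p : ℝ) ^ 2 / η)
  have hm0 : (0 : ℝ) < m := lt_of_le_of_lt (by positivity) hm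
  obtain ⟨h⟩ : Nonempty (Fin m ↪ S) :=
    ⟨(Fin.valEmbedding).trans (Set.Infinite.natEmbedding S hS)⟩
  refine trace_le_of_mem_span hA (fun e : s => D e) x
    (fun e => ∑ j, powSum p (e * (h j : G))) ?_ w ?_ hwA (m : ℂ)⁻¹ ?_
  · intro e
    rw [Finset.sum_smul]
    refine Submodule.sum_mem _ fun j _ => ?_
    rw [powSum_smul_derivation hD hG]
    exact Submodule.smul_mem _ _ (hx _ (h j).2)
  · intro i
    have := hs i
    rwa [Set.image_eq_range] at this
  · refine (Finset.sum_le_sum fun (e : s) _ => norm_vac_sub_average_le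
      (h := fun j => (h j : G)) hp hG (e : G) (by exact_mod_cast hm0) (Subtype.val_injective.comp h.injective)).trans ?_
    rw [Finset.sum_const, Finset.card_univ, Fintype.card_coe, nsmul_eq_mul, ← mul_div_assoc,
      div_le_iff₀ hm0]
    rw [div_lt_iff₀ hη] at hm
    linarith

theorem trace_le_two {p : ℕ} (hp : p.Prime) (hG : ∀ g : G, g ^ p = 1)
    {n : ℕ} {A : Matrix (Fin n) (Fin n) (VN G)} (hA : A * A = A) (w : Fin n → M)
    (hw : ∀ i, w i ∈ Submodule.span (VN G) (Set.range D))
    (hwA : ∀ v : Fin n → VN G, ∑ i, v i • w i = 0 → ∀ j, ∑ i, v i * A i j = 0) :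
    (∑ i, vnTrace (A i i)).re ≤ 2 := by
  classical
  -- The condition forces local finiteness, by adjoining elements one at a time. Its failure
  -- supplies the infinite subgroup `⟨K, g⟩`, on which two elements span the values of `D`.
  by_cases hfin : ∀ (K : Subgroup G) (g : G), Finite K →
      Finite (Subgroup.closure (insert g (K : Set G)))
  · obtain ⟨s, hs⟩ := exists_finset_mem_span hw
    obtain ⟨K, hK, hsK⟩ : ∃ K : Subgroup G, Finite K ∧ (s : Set G) ⊆ K := by
      clear hs
      induction s using Finset.induction_on with
      | empty => exact ⟨⊥, inferInstance, by simp⟩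
      | insert a s _ ih =>
        obtain ⟨K, hK, hsK⟩ := ih
        refine ⟨_, hfin K a hK, ?_⟩
        rw [Finset.coe_insert]
        exact (Set.insert_subset_insert hsK).trans Subgroup.subset_closure
    have := Fintype.ofFinite K
    have h := trace_le_of_mem_span hA (fun _ : Unit => ∑ k : K, D k)
      (fun _ : Unit => ∑ k : K, D k) (fun _ => 1)
      (fun e => by rw [one_smul]; exact Submodule.subset_span ⟨e, rfl⟩) w
      (fun i => by
        refine (Submodule.span_le (p := Submodule.span (VN G) _)).2 ?_ (hs i)
        rintro _ ⟨g, hg, rfl⟩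
        rw [Set.range_const]
        exact derivation_mem_span_of_finite hD K (hsK hg)) hwA 1 (δ := 0)
      (by simp [VN.op_one])
    refine h.trans ?_
    norm_num
  · push Not at hfin
    obtain ⟨K, g, hK, hinf⟩ := hfin
    have := Fintype.ofFinite K
    have h := trace_le_of_infinite hD hp hG ![∑ k : K, D k, D g]
      (S := Subgroup.closure (insert g (K : Set G))) (Set.infinite_coe_iff.1 hinf)
      (fun h hh => by
        refine derivation_mem_of_mem_closure hD _ ?_ hh
        rintro a (rfl | ha)
        · exact Submodule.subset_span ⟨1, rfl⟩
        · refine Submodule.span_mono ?_ (derivation_mem_span_of_finite hD K ha)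
          rw [Set.singleton_subset_iff]
          exact ⟨0, rfl⟩) hA w hw hwA
    simpa using h

end Derivation

/-! ### From `H₁` to the bar derivation, and the conclusion. -/

section Homology

variable {R A B C : Type*} [Ring R] [AddCommGroup A] [AddCommGroup B] [AddCommGroup C]
  [Module R A] [Module R B] [Module R C] (f : A →ₗ[R] B) (g : B →ₗ[R] C)

/-- The class of a cycle in homology. -/
def Homology.mk : LinearMap.ker g →ₗ[R] Homology f g :=
  ((LinearMap.range f).submoduleOf (LinearMap.ker g)).mkQ

theorem Homology.mk_surjective : Function.Surjective (Homology.mk f g) :=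
  Submodule.mkQ_surjective _

theorem Homology.mk_eq_zero (z : LinearMap.ker g) :
    Homology.mk f g z = 0 ↔ (z : B) ∈ LinearMap.range f :=
  Submodule.Quotient.mk_eq_zero _

end Homology

/-- The map that sends `g` to the class of the bar `[g]` modulo boundaries. -/
def barClass {G : Type*} [Group G] (g : G) : (G →₀ VN G) ⧸ LinearMap.range (d₂ G) :=
  (LinearMap.range (d₂ G)).mkQ (Finsupp.single g 1)

/-- The derivation rule is the vanishing of `d₂ [g|h]` in the quotient. -/
theorem barClass_mul {G : Type*} [Group G] (g h : G) :
    barClass (g * h) = barClass g + incl g • barClass h := by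
  have h1 : (LinearMap.range (d₂ G)).mkQ (d₂ G (Finsupp.single (g, h) 1)) = 0 :=
    (Submodule.Quotient.mk_eq_zero _).2 ⟨_, rfl⟩
  rw [d₂, Finsupp.linearCombination_single, one_smul, map_add, map_sub] at h1
  have h2 : (Finsupp.single h (incl g) : G →₀ VN G) = incl g • Finsupp.single h 1 := by
    rw [Finsupp.smul_single, smul_eq_mul, mul_one]
  rw [h2, map_smul, sub_add_eq_add_sub, sub_eq_zero] at h1
  exact h1.symm.trans (add_comm _ _)

theorem mkQ_mem_span_barClass {G : Type*} [Group G] (z : G →₀ VN G) :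
    (LinearMap.range (d₂ G)).mkQ z ∈ Submodule.span (VN G) (Set.range (barClass (G := G))) := by
  induction z using Finsupp.induction_linear with
  | zero => rw [map_zero]; exact Submodule.zero_mem _
  | add a b ha hb => rw [map_add]; exact Submodule.add_mem _ ha hb
  | single g a =>
    rw [← mul_one a, ← smul_eq_mul, ← Finsupp.smul_single, map_smul]
    exact Submodule.smul_mem _ _ (Submodule.subset_span ⟨g, rfl⟩)

theorem trace_le_two_of_injective {G : Type*} [Group G] {p : ℕ} (hp : p.Prime)
    (hG : ∀ g : G, g ^ p = 1) {n : ℕ} {A : Matrix (Fin n) (Fin n) (VN G)}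
    (hA : IsIdempotentElem A) (f : rowModule A →ₗ[VN G] H₁ G) (hf : Function.Injective f) :
    (∑ i, vnTrace (A i i)).re ≤ 2 := by
  set row : Fin n → rowModule A := fun i => ⟨Matrix.toLinearMapRight' A (Pi.single i 1), _, rfl⟩
  -- Cycles representing the images of the rows of `A`. Since `f` is injective, a relation `v` among
  -- their classes forces `v A = 0`, as `trace_le_two` requires.
  choose z hz using fun i => Homology.mk_surjective (d₂ G) (d₁ G) (f (row i))
  refine trace_le_two barClass_mul hp hG hA (fun i => (LinearMap.range (d₂ G)).mkQ (z i))
    (fun i => mkQ_mem_span_barClass _) fun v hv j => ?_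
  have h1 : Homology.mk (d₂ G) (d₁ G) (∑ i, v i • z i) = 0 := by
    rw [Homology.mk_eq_zero, ← Submodule.Quotient.mk_eq_zero, ← Submodule.mkQ_apply,
      AddSubmonoidClass.coe_finsetSum, map_sum, ← hv]
    exact Finset.sum_congr rfl fun i _ => by rw [Submodule.coe_smul, map_smul]
  have h2 : f (∑ i, v i • row i) = 0 := by
    rw [← h1, map_sum, map_sum]
    exact Finset.sum_congr rfl fun i _ => by rw [map_smul, map_smul, hz]
  have h3 : ∑ i, v i • row i = 0 := hf (h2.trans (map_zero f).symm)
  have h4 := congrFun (congrArg Subtype.val h3) j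
  rw [AddSubmonoidClass.coe_finsetSum, Finset.sum_apply] at h4
  refine Eq.trans (Finset.sum_congr rfl fun i _ => ?_) h4
  have h5 : (row i : Fin n → VN G) j = A i j :=
    (congrFun (Matrix.toLinearMapRight'_apply A _) j).trans
      (congrFun (Matrix.single_one_vecMul i A) j)
  rw [Submodule.coe_smul, Pi.smul_apply, smul_eq_mul, h5]

theorem b₁_le_two {G : Type*} [Group G] {p : ℕ} (hp : p.Prime) (hG : ∀ g : G, g ^ p = 1) :
    b₁ G ≤ ENNReal.ofReal 2 :=
  iSup_le fun _ => iSup_le fun _ => iSup_le fun hA => iSup_le fun ⟨f, hf⟩ =>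
    ENNReal.ofReal_le_ofReal (trace_le_two_of_injective hp hG hA f hf)

end L2Betti

end

theorem theorem1 {G : Type*} [Group G] (p : ℕ) (hp : p.Prime) (hG : ∀ g : G, g ^ p = 1) :
    L2Betti.b₁ G ≤ ENNReal.ofReal (2 * (p : ℝ) - 2) ∧
      L2Betti.bBar₁ G ≤ ENNReal.ofReal (2 * (p : ℝ) - 2) := by
  have h2 : ENNReal.ofReal 2 ≤ ENNReal.ofReal (2 * (p : ℝ) - 2) := by
    refine ENNReal.ofReal_le_ofReal ?_
    have : (2 : ℝ) ≤ p := by exact_mod_cast hp.two_le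
    linarith
  refine ⟨(L2Betti.b₁_le_two hp hG).trans h2, ?_⟩
  have : Nonempty {H : Subgroup G // H.FG} := ⟨⟨⊥, Subgroup.FG.bot⟩⟩
  have : IsDirectedOrder {H : Subgroup G // H.FG} :=
    ⟨fun H K => ⟨⟨H.1 ⊔ K.1, H.2.sup K.2⟩, le_sup_left (a := H.1), le_sup_right (a := H.1)⟩⟩
  refine Filter.liminf_le_of_frequently_le' (Filter.Frequently.of_forall fun H => ?_)
  -- Exponent `p` passes to subgroups, so every term of the limit inferior obeys the bound.
  exact (L2Betti.b₁_le_two hp fun g => Subtype.ext (hG g)).trans h2
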